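/- For every positive integer $n$, the edges of the complete bipartite graph $K_{n,n}$ can be properly colored with $n$ colors (that is, any two distinct edges sharing a vertex receive different colors; equivalently, since $K_{n,n}$ is $n$-regular, the $n$ color classes form a one-factorization of $K_{n,n}$) in such a way that, for any two distinct colors, every cycle in the union of the two corresponding color classes has length at most $182$. -/

import Mathlib

/-- An edge labeling is a proper edge-coloring if any two distinct edges sharing a vertex
receive distinct labels. -/
def IsProperEdgeColoring {V K : Type*} {G : SimpleGraph V} (C : G.EdgeLabeling K) : Prop :=
  ∀ e f : G.edgeSet, e ≠ f → (∃ v : V, v ∈ (e : Sym2 V) ∧ v ∈ (f : Sym2 V)) → C e ≠ C f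

/-- The graph formed by the union of the two color classes `i` and `j`. -/
def twoColoredGraph {V K : Type*} {G : SimpleGraph V} (C : G.EdgeLabeling K) (i j : K) :
    SimpleGraph V :=
  C.labelGraph i ⊔ C.labelGraph j

/-! Colour the edge joining column y to symbol M a y by the row a of a Latin square. If two rows
both carry a column set S to a symbol set S', no two-coloured cycle leaves S ⊔ S', so it suffices to
cover the columns by such pairs of size at most 54; cycles then have length at most 108. Such
squares are built by induction over rings of characteristic 3, passing from V to `ZMod 3 × V`.
Writing an order as k * 3 ^ e + v with k ≤ 2 and v ≤ 3 ^ e, `prolong` takes the product of a square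
of order k with (r, c) ↦ -r - c and replaces the entries on the transversals c - r = d, d ∈ U, to
make room for v new rows, columns and symbols. Two old rows differ by translations of order 3, as do
two new rows outside the old square. An old row against a new row w also produces the reflection y ↦
-w - y, which is why `reflect` is carried along. Its bound 18 = 3 * 6 reproduces itself, and 54 = 3
* 18. -/

/-- `M` restricts to a Latin square on `U`, the permutation between any two of its rows preserves
small sets of columns covering `U`, and each row `w`, together with the reflection `y ↦ -w - y`,
preserves small sets covering the whole ring. -/
structure IsShortLatin {V : Type} [CommRing V] (U : Finset V) (M : V → V → V) : Prop where
  mem : ∀ a ∈ U, ∀ y ∈ U, M a y ∈ U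
  row_inj : ∀ a ∈ U, ∀ y ∈ U, ∀ z ∈ U, M a y = M a z → y = z
  col_inj : ∀ a ∈ U, ∀ b ∈ U, ∀ y ∈ U, M a y = M b y → a = b
  rows : ∀ a ∈ U, ∀ b ∈ U, ∀ x ∈ U, ∃ S S' : Finset V, x ∈ S ∧ S.card ≤ 54 ∧ S'.card ≤ 54 ∧
    ∀ y ∈ U, (M a y ∈ S' ↔ y ∈ S) ∧ (M b y ∈ S' ↔ y ∈ S)
  reflect : ∀ w ∈ U, ∀ x, ∃ S : Finset V, x ∈ S ∧ S.card ≤ 18 ∧ (∀ y, -w - y ∈ S ↔ y ∈ S) ∧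
    ∀ y ∈ U, (M w y ∈ S ↔ y ∈ S)

/-- A Latin square `L` on `A ∪ {0}` with zero as identity and a Latin square `K` on `A`. -/
structure IsLatinPair (A : Finset (ZMod 3)) (L K : ZMod 3 → ZMod 3 → ZMod 3) : Prop where
  zero_notMem : 0 ∉ A
  zero_left : ∀ j, L 0 j = j
  zero_right : ∀ i, L i 0 = i
  mem : ∀ i ∈ A, ∀ j ∈ A, L i j = 0 ∨ L i j ∈ A
  row_inj : ∀ i ∈ A, ∀ j ∈ insert 0 A, ∀ l ∈ insert 0 A, L i j = L i l → j = l
  col_inj : ∀ i ∈ A, ∀ j ∈ insert 0 A, ∀ l ∈ insert 0 A, L j i = L l i → j = l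
  mem' : ∀ i ∈ A, ∀ j ∈ A, K i j ∈ A
  row_inj' : ∀ i ∈ A, ∀ j ∈ A, ∀ l ∈ A, K i j = K i l → j = l
  col_inj' : ∀ i ∈ A, ∀ j ∈ A, ∀ l ∈ A, K j i = K l i → j = l

theorem exists_isLatinPair (k : ℕ) (hk : k ≤ 2) :
    ∃ A L K, IsLatinPair A L K ∧ A.card = k := by
  interval_cases k
  · exact ⟨∅, (· + ·), (· + ·), by constructor <;> decide, rfl⟩
  · exact ⟨{1}, fun i j => if i = 1 ∧ j = 1 then 0 else i + j, fun _ _ => 1,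
      by constructor <;> decide, rfl⟩
  · exact ⟨{1, 2}, (· + ·), fun i j => if i = j then 1 else 2, by constructor <;> decide, rfl⟩

/-! ### Small invariant sets in characteristic 3. -/

/-- The subset of `ZMod 3 × V` with fibre `Q` over zero and fibre `P` elsewhere. -/
def fibres {V : Type} [DecidableEq V] (P Q : Finset V) : Finset (ZMod 3 × V) :=
  ({1, 2} ×ˢ P) ∪ ({0} ×ˢ Q)

theorem mem_fibres {V : Type} [DecidableEq V] {P Q : Finset V} (i : ZMod 3) (x : V) :
    (i, x) ∈ fibres P Q ↔ if i = 0 then x ∈ Q else x ∈ P := by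
  have h1 : (0 : ZMod 3) ≠ 1 := by decide
  have h2 : (0 : ZMod 3) ≠ 2 := by decide
  have : i = 0 ∨ i = 1 ∨ i = 2 := by revert i; decide
  rcases this with rfl | rfl | rfl <;> simp [fibres, h1, h2, h1.symm, h2.symm]

theorem card_fibres_le {V : Type} [DecidableEq V] (P Q : Finset V) :
    (fibres P Q).card ≤ 2 * P.card + Q.card := by
  refine (Finset.card_union_le _ _).trans ?_
  rw [Finset.card_product, Finset.card_product, Finset.card_singleton, one_mul]
  gcongr
  exact Finset.card_le_two

/-- The points `±c + t * r` with `t ∈ {0, 1, -1}`. -/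
def doubleLine {V : Type} [CommRing V] [DecidableEq V] (c r : V) : Finset V :=
  {c, c + r, c - r, -c, -c + r, -c - r}

theorem card_doubleLine_le {V : Type} [CommRing V] [DecidableEq V] (c r : V) :
    (doubleLine c r).card ≤ 6 :=
  Finset.card_le_six

theorem mem_doubleLine {V : Type} [CommRing V] [DecidableEq V] {c r x : V} :
    x ∈ doubleLine c r ↔
      x = c ∨ x = c + r ∨ x = c - r ∨ x = -c ∨ x = -c + r ∨ x = -c - r := by
  simp [doubleLine]

theorem neg_mem_doubleLine {V : Type} [CommRing V] [DecidableEq V] {c r x : V} :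
    -x ∈ doubleLine c r ↔ x ∈ doubleLine c r := by
  simp only [mem_doubleLine]
  grind

theorem add_mem_doubleLine {V : Type} [CommRing V] [DecidableEq V] (h3 : (3 : V) = 0)
    {c r x : V} : x + r ∈ doubleLine c r ↔ x ∈ doubleLine c r := by
  simp only [mem_doubleLine]
  grind

theorem sub_mem_doubleLine {V : Type} [CommRing V] [DecidableEq V] (h3 : (3 : V) = 0)
    {c r x : V} : x - r ∈ doubleLine c r ↔ x ∈ doubleLine c r := by
  rw [← add_mem_doubleLine h3, sub_add_cancel]

theorem neg_sub_mem_doubleLine {V : Type} [CommRing V] [DecidableEq V] (h3 : (3 : V) = 0)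
    {c r x : V} :
    -r - x ∈ doubleLine c r ↔ x ∈ doubleLine c r := by
  rw [show -r - x = -x - r by ring, sub_mem_doubleLine h3, neg_mem_doubleLine]

theorem card_filter_mem_le_of_injective {V : Type} [Fintype V] [DecidableEq V]
    {f : V → V} (hf : f.Injective) (P : Finset V) :
    (Finset.univ.filter fun y => f y ∈ P).card ≤ P.card :=
  Finset.card_le_card_of_injOn f (by intro y; simp) hf.injOn

/-! ### Prolongation and its invariant sets. -/

/-- The product of a Latin square of order `A.card` with the additive group of `V`, prolonged by
the Latin square `M` on `U ⊆ V`. -/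
def prolong {V : Type} [CommRing V] [DecidableEq V] (L K : ZMod 3 → ZMod 3 → ZMod 3)
    (U : Finset V) (M : V → V → V) (a b : ZMod 3 × V) : ZMod 3 × V :=
  if a.1 = 0 then
    if b.1 = 0 then (0, M a.2 b.2) else (b.1, a.2 + b.2)
  else if b.1 = 0 then (a.1, a.2 - b.2)
  else if b.2 - a.2 ∈ U then
    if L a.1 b.1 = 0 then (0, b.2 - a.2) else (L a.1 b.1, -a.2 - b.2)
  else (K a.1 b.1, -a.2 - b.2)

/-- The underlying set of `prolong`. -/
def prolongSet {V : Type} [Fintype V] [DecidableEq V] (A : Finset (ZMod 3)) (U : Finset V) :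
    Finset (ZMod 3 × V) :=
  (A ×ˢ Finset.univ) ∪ ({0} ×ˢ U)

theorem mem_prolongSet {V : Type} [Fintype V] [DecidableEq V] {A : Finset (ZMod 3)}
    {U : Finset V} (hA : 0 ∉ A) (i : ZMod 3) (x : V) :
    (i, x) ∈ prolongSet A U ↔ (i ∈ A ∧ i ≠ 0) ∨ (i = 0 ∧ x ∈ U) := by
  simp only [prolongSet, Finset.mem_union, Finset.mem_product, Finset.mem_singleton,
    Finset.mem_univ, and_true]
  have : i ∈ A → i ≠ 0 := fun h h' => hA (h' ▸ h)
  tauto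

theorem card_prolongSet {V : Type} [Fintype V] [DecidableEq V] {A : Finset (ZMod 3)}
    {U : Finset V} (hA : 0 ∉ A) :
    (prolongSet A U).card = A.card * Fintype.card V + U.card := by
  rw [prolongSet, Finset.card_union_of_disjoint, Finset.card_product, Finset.card_product,
    Finset.card_singleton, one_mul, Finset.card_univ]
  rw [Finset.disjoint_product]
  exact Or.inl (Finset.disjoint_singleton_right.2 hA)

namespace IsShortLatin

variable {V : Type} [CommRing V] [Fintype V] [DecidableEq V] {U : Finset V} {M : V → V → V}
  {A : Finset (ZMod 3)} {L K : ZMod 3 → ZMod 3 → ZMod 3}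

theorem prolong_mem (h : IsShortLatin U M) (hL : IsLatinPair A L K) :
    ∀ a ∈ prolongSet A U, ∀ y ∈ prolongSet A U, prolong L K U M a y ∈ prolongSet A U := by
  rintro ⟨i, r⟩ ha ⟨j, c⟩ hy
  have hm := mem_prolongSet (U := U) hL.zero_notMem
  rw [hm] at ha hy
  obtain ⟨h0, -, -, hm1, -, -, hm2, -, -⟩ := hL
  have hm3 := h.mem
  unfold prolong
  dsimp only
  split_ifs <;> rw [hm] <;> grind

theorem prolong_row_inj (h3 : (3 : V) = 0) (h : IsShortLatin U M) (hL : IsLatinPair A L K) :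
    ∀ a ∈ prolongSet A U, ∀ y ∈ prolongSet A U, ∀ z ∈ prolongSet A U,
      prolong L K U M a y = prolong L K U M a z → y = z := by
  rintro ⟨i, r⟩ ha ⟨j, c⟩ hy ⟨l, d⟩ hz
  have hm := mem_prolongSet (U := U) hL.zero_notMem
  rw [hm] at ha hy hz
  clear hm
  have hM := fun hr hc hd => h.row_inj r hr c hc d hd
  have h0 := hL.zero_notMem
  have hz := hL.zero_right i
  have hL1 := fun hi => hL.row_inj i hi j
  have hL2 := fun hi => hL.row_inj i hi l
  have hK := fun hi hj hl => hL.row_inj' i hi j hj l hl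
  have hK1 := hL.mem' i
  -- The entry displaced from the cell c = r + d is -r - c = r - d because 3 = 0; this is what the
  -- row holds in the new column d.
  have e1 : r - c = -r - d → c = d - r := fun h => by linear_combination -h + r * h3
  have e2 : -r - c = r - d → d = c - r := fun h => by linear_combination h + r * h3
  simp only [Finset.mem_insert] at hL1 hL2
  unfold prolong
  dsimp only
  split_ifs <;> simp only [Prod.mk.injEq] <;> grind

theorem prolong_col_inj (h3 : (3 : V) = 0) (h : IsShortLatin U M) (hL : IsLatinPair A L K) :
    ∀ a ∈ prolongSet A U, ∀ b ∈ prolongSet A U, ∀ y ∈ prolongSet A U,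
      prolong L K U M a y = prolong L K U M b y → a = b := by
  rintro ⟨j, c⟩ hy ⟨l, d⟩ hz ⟨i, r⟩ ha
  have hm := mem_prolongSet (U := U) hL.zero_notMem
  rw [hm] at ha hy hz
  clear hm
  have hM := fun hc hd hr => h.col_inj c hc d hd r hr
  have h0 := hL.zero_notMem
  have hz := hL.zero_left i
  have hL1 := fun hi => hL.col_inj i hi j
  have hL2 := fun hi => hL.col_inj i hi l
  have hK := fun hi hj hl => hL.col_inj' i hi j hj l hl
  have hK1 := fun hi hj => hL.mem' j hj i hi
  have hK2 := fun hi hl => hL.mem' l hl i hi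
  have e1 : c + r = -d - r → c = r - d := fun h => by linear_combination h - r * h3
  have e2 : -c - r = d + r → d = r - c := fun h => by linear_combination -h - r * h3
  simp only [Finset.mem_insert] at hL1 hL2
  unfold prolong
  dsimp only
  split_ifs <;> simp only [Prod.mk.injEq] <;> grind

/-- An old row acts on second coordinates by c ↦ -r - c, by c ↦ c - r into the zero fibre, and by c
↦ r - c out of it. Compatibility with the third map follows from the other two since 3 * r = 0. The
nonzero fibres carry equal sets, so the values of `L` and `K` matter only through being zero or not.
-/
theorem prolong_mem_fibres (h3 : (3 : V) = 0) (hL : IsLatinPair A L K) {i : ZMod 3}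
    (hi : i ≠ 0) {r : V} {P P' Q : Finset V} (hP : ∀ c, -r - c ∈ P' ↔ c ∈ P)
    (hQ : ∀ c, c - r ∈ Q ↔ c ∈ P) (ha : (i, r) ∈ prolongSet A U) :
    ∀ y ∈ prolongSet A U, prolong L K U M (i, r) y ∈ fibres P' Q ↔ y ∈ fibres P Q := by
  rintro ⟨j, c⟩ hy
  have h0 := hL.zero_notMem
  rw [mem_prolongSet h0] at ha hy
  have hK := hL.mem' i
  have hr : r - c ∈ P' ↔ c ∈ Q := by
    rw [show r - c = -r - (r + c) by linear_combination r * h3, hP, ← hQ, add_sub_cancel_left]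
  have hPc := hP c
  have hQc := hQ c
  unfold prolong
  dsimp only
  split_ifs <;> simp only [mem_fibres] <;> grind

theorem prolong_zero_mem_fibres (hL : IsLatinPair A L K) {w : V} {P P' Q Q' : Finset V}
    (hP : ∀ c, w + c ∈ P' ↔ c ∈ P) (hQ : ∀ y ∈ U, M w y ∈ Q' ↔ y ∈ Q) :
    ∀ y ∈ prolongSet A U, prolong L K U M (0, w) y ∈ fibres P' Q' ↔ y ∈ fibres P Q := by
  rintro ⟨j, c⟩ hy
  rw [mem_prolongSet hL.zero_notMem] at hy
  unfold prolong
  dsimp only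
  split_ifs <;> simp only [mem_fibres] <;> grind

theorem exists_sets_of_ne_zero (h3 : (3 : V) = 0) (hL : IsLatinPair A L K) {i i' : ZMod 3}
    (hi : i ≠ 0) (hi' : i' ≠ 0) {r r' : V} (ha : (i, r) ∈ prolongSet A U)
    (hb : (i', r') ∈ prolongSet A U) (x : ZMod 3 × V) :
    ∃ S S' : Finset (ZMod 3 × V), x ∈ S ∧ S.card ≤ 54 ∧ S'.card ≤ 54 ∧
      ∀ y ∈ prolongSet A U, (prolong L K U M (i, r) y ∈ S' ↔ y ∈ S) ∧
        (prolong L K U M (i', r') y ∈ S' ↔ y ∈ S) := by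
  obtain ⟨j, c⟩ := x
  -- Comparing the two rows translates by ±(r - r'); the zero fibre is read through y ↦ y + r.
  set P := doubleLine (if j = 0 then c + r else c) (r - r') with hPdef
  have hP : P.card ≤ 6 := card_doubleLine_le _ _
  have hQ' := card_filter_mem_le_of_injective (add_left_injective r) P
  have hP' := card_filter_mem_le_of_injective (sub_right_injective (b := -r)) P
  set Q := Finset.univ.filter fun y => y + r ∈ P with hQdef
  set P' := Finset.univ.filter fun y => -r - y ∈ P with hPdef'
  have hS := card_fibres_le P Q
  have hS' := card_fibres_le P' Q
  refine ⟨fibres P Q, fibres P' Q, ?_, by lia, by lia, fun y hy =>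
    ⟨prolong_mem_fibres h3 hL hi ?_ ?_ ha y hy, prolong_mem_fibres h3 hL hi' ?_ ?_ hb y hy⟩⟩
  · rw [mem_fibres]
    split_ifs with hj <;> simp [hQdef, hPdef, hj, mem_doubleLine]
  · intro c
    simp [hPdef']
  · intro c
    simp [hQdef]
  · intro c
    simp only [hPdef', Finset.mem_filter, Finset.mem_univ, true_and]
    rw [show -r - (-r' - c) = c - (r - r') by ring, hPdef, sub_mem_doubleLine h3]
  · intro c
    simp only [hQdef, Finset.mem_filter, Finset.mem_univ, true_and]
    rw [show c - r' + r = c + (r - r') by ring, hPdef, add_mem_doubleLine h3]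

/-- In the coordinate y = c - r, comparing c ↦ -r - c with c ↦ w + c gives y ↦ -w - y, so the sets
from `reflect` serve on all three fibres. -/
theorem exists_sets_of_ne_zero_of_eq_zero (h3 : (3 : V) = 0) (h : IsShortLatin U M)
    (hL : IsLatinPair A L K) {i : ZMod 3} (hi : i ≠ 0) {r w : V}
    (ha : (i, r) ∈ prolongSet A U) (hw : w ∈ U) (x : ZMod 3 × V) :
    ∃ S S' : Finset (ZMod 3 × V), x ∈ S ∧ S.card ≤ 54 ∧ S'.card ≤ 54 ∧
      ∀ y ∈ prolongSet A U, (prolong L K U M (i, r) y ∈ S' ↔ y ∈ S) ∧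
        (prolong L K U M (0, w) y ∈ S' ↔ y ∈ S) := by
  obtain ⟨j, c⟩ := x
  obtain ⟨Q, hcQ, hQ, hQw, hQM⟩ := h.reflect w hw (if j = 0 then c else c - r)
  have hP := card_filter_mem_le_of_injective (sub_left_injective (b := r)) Q
  have hP' := card_filter_mem_le_of_injective (sub_right_injective (b := r)) Q
  set P := Finset.univ.filter fun y => y - r ∈ Q with hPdef
  set P' := Finset.univ.filter fun y => r - y ∈ Q with hPdef'
  have hS := card_fibres_le P Q
  have hS' := card_fibres_le P' Q
  refine ⟨fibres P Q, fibres P' Q, ?_, by lia, by lia, fun y hy =>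
    ⟨prolong_mem_fibres h3 hL hi ?_ ?_ ha y hy, prolong_zero_mem_fibres hL ?_ hQM y hy⟩⟩
  · rw [mem_fibres]
    split_ifs at hcQ ⊢ <;> simpa [hPdef] using hcQ
  · intro c
    simp only [hPdef', hPdef, Finset.mem_filter, Finset.mem_univ, true_and]
    rw [show r - (-r - c) = c - r by linear_combination r * h3]
  · intro c
    simp [hPdef]
  · intro c
    simp only [hPdef', hPdef, Finset.mem_filter, Finset.mem_univ, true_and]
    rw [← hQw (c - r), show -w - (c - r) = r - (w + c) by ring]

theorem exists_sets_of_eq_zero (h3 : (3 : V) = 0) (h : IsShortLatin U M)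
    (hL : IsLatinPair A L K) {w w' : V} (hw : w ∈ U) (hw' : w' ∈ U) {x : ZMod 3 × V}
    (hx : x ∈ prolongSet A U) :
    ∃ S S' : Finset (ZMod 3 × V), x ∈ S ∧ S.card ≤ 54 ∧ S'.card ≤ 54 ∧
      ∀ y ∈ prolongSet A U, (prolong L K U M (0, w) y ∈ S' ↔ y ∈ S) ∧
        (prolong L K U M (0, w') y ∈ S' ↔ y ∈ S) := by
  obtain ⟨j, c⟩ := x
  rw [mem_prolongSet hL.zero_notMem] at hx
  by_cases hj : j = 0
  · obtain ⟨Q, Q', hcQ, hQ, hQ', hM⟩ := h.rows w hw w' hw' c (by tauto)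
    have hS := card_fibres_le ∅ Q
    have hS' := card_fibres_le ∅ Q'
    rw [Finset.card_empty] at hS hS'
    refine ⟨fibres ∅ Q, fibres ∅ Q', ?_, by lia, by lia, fun y hy =>
      ⟨prolong_zero_mem_fibres hL (by simp) (fun y hy => (hM y hy).1) y hy,
        prolong_zero_mem_fibres hL (by simp) (fun y hy => (hM y hy).2) y hy⟩⟩
    rwa [mem_fibres, if_pos hj]
  · set P := doubleLine c (w - w') with hPdef
    have hP : P.card ≤ 6 := card_doubleLine_le _ _
    have hP' := card_filter_mem_le_of_injective (sub_left_injective (b := w)) P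
    set P' := Finset.univ.filter fun y => y - w ∈ P with hPdef'
    have hS := card_fibres_le P ∅
    have hS' := card_fibres_le P' ∅
    rw [Finset.card_empty] at hS hS'
    refine ⟨fibres P ∅, fibres P' ∅, ?_, by lia, by lia, fun y hy =>
      ⟨prolong_zero_mem_fibres hL ?_ (by simp) y hy,
        prolong_zero_mem_fibres hL ?_ (by simp) y hy⟩⟩
    · rw [mem_fibres, if_neg hj]
      simp [hPdef, mem_doubleLine]
    · intro c
      simp [hPdef']
    · intro c
      simp only [hPdef', Finset.mem_filter, Finset.mem_univ, true_and]
      rw [show w' + c - w = c - (w - w') by ring, hPdef, sub_mem_doubleLine h3]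

theorem prolong_rows (h3 : (3 : V) = 0) (h : IsShortLatin U M) (hL : IsLatinPair A L K) :
    ∀ a ∈ prolongSet A U, ∀ b ∈ prolongSet A U, ∀ x ∈ prolongSet A U,
      ∃ S S' : Finset (ZMod 3 × V), x ∈ S ∧ S.card ≤ 54 ∧ S'.card ≤ 54 ∧
        ∀ y ∈ prolongSet A U, (prolong L K U M a y ∈ S' ↔ y ∈ S) ∧
          (prolong L K U M b y ∈ S' ↔ y ∈ S) := by
  rintro ⟨i, r⟩ ha ⟨i', r'⟩ hb x hx
  have hm := mem_prolongSet (U := U) hL.zero_notMem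
  by_cases hi : i = 0 <;> by_cases hi' : i' = 0
  · subst hi hi'
    rw [hm] at ha hb
    exact exists_sets_of_eq_zero h3 h hL (by tauto) (by tauto) hx
  · subst hi
    rw [hm] at ha
    obtain ⟨S, S', hxS, hS, hS', hM⟩ :=
      exists_sets_of_ne_zero_of_eq_zero h3 h hL hi' hb (w := r) (by tauto) x
    exact ⟨S, S', hxS, hS, hS', fun y hy => (hM y hy).symm⟩
  · subst hi'
    rw [hm] at hb
    exact exists_sets_of_ne_zero_of_eq_zero h3 h hL hi ha (by tauto) x
  · exact exists_sets_of_ne_zero h3 hL hi hi' ha hb x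

theorem prolong_reflect (h3 : (3 : V) = 0) (h : IsShortLatin U M) (hL : IsLatinPair A L K) :
    ∀ w ∈ prolongSet A U, ∀ x, ∃ S : Finset (ZMod 3 × V), x ∈ S ∧ S.card ≤ 18 ∧
      (∀ y, -w - y ∈ S ↔ y ∈ S) ∧
      ∀ y ∈ prolongSet A U, (prolong L K U M w y ∈ S ↔ y ∈ S) := by
  rintro ⟨i, r⟩ ha ⟨j, c⟩
  have hD := card_doubleLine_le c r
  have hcD : c ∈ doubleLine c r := by simp [mem_doubleLine]
  have hD' := fun x => neg_sub_mem_doubleLine h3 (c := c) (r := r) (x := x)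
  by_cases hi : i = 0
  · subst hi
    have hr : r ∈ U := by
      rw [mem_prolongSet hL.zero_notMem] at ha
      tauto
    by_cases hj : j = 0
    · obtain ⟨Q, hcQ, hQ, hQw, hQM⟩ := h.reflect r hr c
      have hS := card_fibres_le ∅ Q
      rw [Finset.card_empty] at hS
      refine ⟨fibres ∅ Q, by simpa [mem_fibres, hj], by lia, ?_,
        prolong_zero_mem_fibres hL (by simp) hQM⟩
      rintro ⟨l, y⟩
      simp [mem_fibres, hQw]
    · have hS := card_fibres_le (doubleLine c r) ∅
      rw [Finset.card_empty] at hS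
      refine ⟨fibres (doubleLine c r) ∅, by simpa [mem_fibres, hj], by lia, ?_,
        prolong_zero_mem_fibres hL ?_ (by simp)⟩
      · rintro ⟨l, y⟩
        simp [mem_fibres, hD']
      · intro y
        rw [add_comm, add_mem_doubleLine h3]
  · have hS := card_fibres_le (doubleLine c r) (doubleLine c r)
    refine ⟨fibres (doubleLine c r) (doubleLine c r), by simpa [mem_fibres], by lia, ?_,
      prolong_mem_fibres h3 hL hi hD' (fun y => sub_mem_doubleLine h3) ha⟩
    rintro ⟨l, y⟩
    simp [mem_fibres, hD']

theorem prolong (h3 : (3 : V) = 0) (h : IsShortLatin U M) (hL : IsLatinPair A L K) :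
    IsShortLatin (prolongSet A U) (prolong L K U M) where
  mem := prolong_mem h hL
  row_inj := prolong_row_inj h3 h hL
  col_inj := prolong_col_inj h3 h hL
  rows := prolong_rows h3 h hL
  reflect := prolong_reflect h3 h hL

end IsShortLatin

/-! ### Induction on the exponent and passage to cycles. -/

theorem exists_isShortLatin (e : ℕ) :
    ∃ (V : Type) (_ : CommRing V) (_ : Fintype V), (3 : V) = 0 ∧ Fintype.card V = 3 ^ e ∧
      ∀ u ≤ 3 ^ e, ∃ (U : Finset V) (M : V → V → V), U.card = u ∧ IsShortLatin U M := by
  classical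
  induction e with
  | zero =>
    refine ⟨PUnit, inferInstance, inferInstance, rfl, rfl, fun u hu => ?_⟩
    obtain ⟨U, -, hU⟩ := Finset.exists_subset_card_eq (s := (Finset.univ : Finset PUnit))
      (n := u) (by simpa using hu)
    exact ⟨U, fun _ y => y, hU, fun _ _ _ h => h, fun _ _ _ _ _ _ h => h,
      fun _ _ _ _ _ _ _ => rfl,
      fun _ _ _ _ _ _ => ⟨{PUnit.unit}, {PUnit.unit}, by simp, by simp, by simp, by simp⟩,
      fun _ _ _ => ⟨{PUnit.unit}, by simp, by simp, by simp, by simp⟩⟩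
  | succ e ih =>
    obtain ⟨V, _, _, h3, hV, ih⟩ := ih
    refine ⟨ZMod 3 × V, inferInstance, inferInstance,
      Prod.ext (show (3 : ZMod 3) = 0 by decide) h3, ?_, ?_⟩
    · rw [Fintype.card_prod, hV, ZMod.card, pow_succ']
    · intro u hu
      -- Allowing v = 3 ^ e lets k ≤ 2 reach the full order 3 ^ (e + 1).
      obtain ⟨k, v, hk, hv, rfl⟩ : ∃ k v, k ≤ 2 ∧ v ≤ 3 ^ e ∧ u = k * 3 ^ e + v := by
        rw [pow_succ'] at hu
        by_cases h1 : u ≤ 3 ^ e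
        · exact ⟨0, u, by lia, h1, by lia⟩
        by_cases h2 : u ≤ 2 * 3 ^ e
        · exact ⟨1, u - 3 ^ e, by lia, by lia, by lia⟩
        · exact ⟨2, u - 2 * 3 ^ e, by lia, by lia, by lia⟩
      obtain ⟨U, M, hU, hM⟩ := ih v hv
      obtain ⟨A, L, K, hL, hA⟩ := exists_isLatinPair k hk
      exact ⟨prolongSet A U, prolong L K U M,
        by rw [card_prolongSet hL.zero_notMem, hA, hU, hV], hM.prolong h3 hL⟩

/-- There is a Latin square of each order such that the permutation between any two of its rows
has cycles of length at most 54. -/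
theorem exists_latinSquare_fin (n : ℕ) :
    ∃ M : Fin n → Fin n → Fin n, (∀ a, (M a).Injective) ∧ (∀ y, (M · y).Injective) ∧
      ∀ a b x, ∃ S S' : Finset (Fin n), x ∈ S ∧ S.card ≤ 54 ∧ S'.card ≤ 54 ∧
        ∀ y, (M a y ∈ S' ↔ y ∈ S) ∧ (M b y ∈ S' ↔ y ∈ S) := by
  classical
  obtain ⟨V, _, _, -, -, h⟩ := exists_isShortLatin n
  obtain ⟨U, M, hU, hM⟩ := h n (Nat.lt_pow_self (by decide)).le
  have φ : Fin n ≃ U := (Finset.equivFinOfCardEq hU).symm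
  refine ⟨fun a y => φ.symm ⟨M (φ a) (φ y), hM.mem _ (φ a).2 _ (φ y).2⟩, ?_, ?_, ?_⟩
  · intro a y z hyz
    simp only [EmbeddingLike.apply_eq_iff_eq, Subtype.mk.injEq] at hyz
    exact φ.injective (Subtype.ext (hM.row_inj _ (φ a).2 _ (φ y).2 _ (φ z).2 hyz))
  · intro y a b hab
    simp only [EmbeddingLike.apply_eq_iff_eq, Subtype.mk.injEq] at hab
    exact φ.injective (Subtype.ext (hM.col_inj _ (φ a).2 _ (φ b).2 _ (φ y).2 hab))
  · intro a b x
    obtain ⟨S, S', hx, hS, hS', hm⟩ := hM.rows _ (φ a).2 _ (φ b).2 _ (φ x).2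
    have hcard (T : Finset V) :
        (Finset.univ.filter fun y => (φ y : V) ∈ T).card ≤ T.card :=
      Finset.card_le_card_of_injOn (fun y => (φ y : V)) (by intro y; simp)
        (Subtype.val_injective.comp φ.injective).injOn
    refine ⟨Finset.univ.filter fun y => (φ y : V) ∈ S, Finset.univ.filter fun y => (φ y : V) ∈ S',
      by simpa using hx, (hcard S).trans hS, (hcard S').trans hS', fun y => ?_⟩
    simpa using hm _ (φ y).2

/-- A walk cannot leave a set closed under adjacency, and the support of a cycle without its first
vertex has no repetition. -/
theorem SimpleGraph.Walk.IsCycle.length_le_card {V : Type*} [DecidableEq V] {G : SimpleGraph V}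
    {v : V} {w : G.Walk v v} (hw : w.IsCycle) (P : Finset V) (hv : v ∈ P)
    (hP : ∀ x y, G.Adj x y → x ∈ P → y ∈ P) : w.length ≤ P.card := by
  have key : ∀ {x y : V} (p : G.Walk x y), x ∈ P → ∀ z ∈ p.support, z ∈ P := by
    intro x y p
    induction p with
    | nil => simp
    | cons h p ih =>
      intro hx z hz
      rw [SimpleGraph.Walk.support_cons, List.mem_cons] at hz
      rcases hz with rfl | hz
      · exact hx
      · exact ih (hP _ _ h hx) z hz
  have hlen : w.support.tail.length = w.length := by simp
  rw [← hlen, ← List.toFinset_card_of_nodup hw.support_nodup]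
  exact Finset.card_le_card fun z hz =>
    key w hv z (List.mem_of_mem_tail (List.mem_toFinset.1 hz))

theorem mainTheorem4 (n : ℕ) (hn : 0 < n) :
    ∃ C : (completeBipartiteGraph (Fin n) (Fin n)).EdgeLabeling (Fin n),
      IsProperEdgeColoring C ∧
        ∀ i j : Fin n, i ≠ j →
          ∀ (v : Fin n ⊕ Fin n) (w : (twoColoredGraph C i j).Walk v v),
            w.IsCycle → w.length ≤ 182 := by
  obtain ⟨M, hrow, hcol, hM⟩ := exists_latinSquare_fin n
  have hedge : ∀ e : (completeBipartiteGraph (Fin n) (Fin n)).edgeSet, ∃ a y,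
      (e : Sym2 (Fin n ⊕ Fin n)) = s(Sum.inl y, Sum.inr (M a y)) := by
    rintro ⟨e, he⟩
    induction e using Sym2.ind with
    | h u v =>
      have hsurj := fun y => Finite.surjective_of_injective (hcol y)
      rw [SimpleGraph.mem_edgeSet, completeBipartiteGraph_adj] at he
      rcases u with y | z <;> rcases v with y' | z' <;> simp at he
      · obtain ⟨a, ha⟩ := hsurj y z'
        exact ⟨a, y, by simp only [← ha]⟩
      · obtain ⟨a, ha⟩ := hsurj y' z
        exact ⟨a, y', by simp only [← ha, Sym2.eq_swap]⟩
  obtain ⟨C, Y, hC⟩ : ∃ (C : (completeBipartiteGraph (Fin n) (Fin n)).EdgeLabeling (Fin n))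
      (Y : (completeBipartiteGraph (Fin n) (Fin n)).edgeSet → Fin n),
      ∀ e, e.val = s(Sum.inl (Y e), Sum.inr (M (C e) (Y e))) := by
    choose C Y hC using hedge
    exact ⟨C, Y, hC⟩
  have hadj : ∀ a u v, (SimpleGraph.EdgeLabeling.labelGraph C a).Adj u v →
      ∃ y, s(u, v) = s(Sum.inl y, Sum.inr (M a y)) := by
    intro a u v h
    rw [SimpleGraph.EdgeLabeling.labelGraph_adj] at h
    obtain ⟨h, rfl⟩ := h
    exact ⟨Y ⟨s(u, v), h⟩, hC ⟨s(u, v), h⟩⟩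
  refine ⟨C, ?_, ?_⟩
  · rintro e f hef ⟨v, hve, hvf⟩ heq
    refine hef (Subtype.ext ?_)
    rw [hC e] at hve ⊢
    rw [hC f, ← heq] at hvf ⊢
    have : Y e = Y f := by
      rw [Sym2.mem_iff] at hve hvf
      rcases hve with rfl | rfl
      · simpa using hvf
      · exact hrow _ (by simpa using hvf)
    rw [this]
  · intro i j _ v w hw
    have hY : ∃ y, v = Sum.inl y ∨ v = Sum.inr (M i y) := by
      rcases v with y | z
      · exact ⟨y, Or.inl rfl⟩
      · obtain ⟨y, rfl⟩ := Finite.surjective_of_injective (hrow i) z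
        exact ⟨y, Or.inr rfl⟩
    obtain ⟨y, hy⟩ := hY
    obtain ⟨S, S', hyS, hS, hS', hSS⟩ := hM i j y
    refine (hw.length_le_card (S.disjSum S') ?_ ?_).trans (by rw [Finset.card_disjSum]; lia)
    · rcases hy with rfl | rfl
      · simpa using hyS
      · simpa using (hSS y).1.2 hyS
    · intro u u' h hu
      rcases h with h | h <;> obtain ⟨z, hz⟩ := hadj _ _ _ h <;> rw [Sym2.eq_iff] at hz <;>
        rcases hz with ⟨rfl, rfl⟩ | ⟨rfl, rfl⟩ <;> simpa [(hSS z).1, (hSS z).2] using hu
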